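/- Let $G=(V,E)$ be a finite simple graph with weights $w_e\ge 0$ on its edges, and write $N(i)$ for the set of neighbours of a node $i$. Assume that $G$ has a unique maximum-weight matching $M^*$, and that the LP relaxation $$\max \sum_{e\in E} w_e x_e\quad\text{subject to}\quad \sum_{j\in N(i)}x_{ij}\le 1\ (i\in V),\qquad x_e\ge 0\ (e\in E)$$ has a unique optimal solution. The LP relaxation is called tight if this solution has all its values in $\{0,1\}$, and loose otherwise. Consider max-product for the distribution $p(x)\propto\prod_{i\in V}\mathbf 1_{\{\sum_{j\in N(i)}x_{ij}\le 1\}}\prod_{e\in E}e^{w_ex_e}$ on $\{0,1\}^E$. All messages are initially $(1,1)$, in each time slot an arbitrary subset of the messages is updated (for the synchronous algorithm, all of them) by the rules $$m_{(i,j)\to i}[1]\leftarrow e^{w_{ij}}m_{j\to(i,j)}[1],\qquad m_{(i,j)\to i}[0]\leftarrow m_{j\to(i,j)}[0],\qquad m_{i\to(i,j)}[1]\leftarrow\prod_{k\in N(i)\setminus j}m_{(k,i)\to i}[0],$$ $$m_{i\to(i,j)}[0]\leftarrow\max\Big\{\prod_{k\in N(i)\setminus j}m_{(k,i)\to i}[0],\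 \max_{k\in N(i)\setminus j}\, m_{(k,i)\to i}[1]\prod_{l\in N(i)\setminus\{j,k\}}m_{(l,i)\to i}[0]\Big\},$$ and the beliefs are $b_{(i,j)}[0]=m_{i\to(i,j)}[0]\,m_{j\to(i,j)}[0]$ and $b_{(i,j)}[1]=e^{w_{ij}}m_{i\to(i,j)}[1]\,m_{j\to(i,j)}[1]$. The full computation tree $\overline T_e(1)$ is the single edge $e$, and $\overline T_e(k)$ is obtained from $\overline T_e(k-1)$ by giving to each leaf $v$ as children copies of all neighbours of $v$ in $G$ except for the one already adjacent to $v$ in the tree. The computation tree $T_e$ of $e$ at a given time is the subtree of some $\overline T_e(k)$ that records the message updates on which the belief $b_e$ at that time depends; it is full up to depth $k$ if it contains $\overline T_e(k)$. The belief $b_e$ is incorrect if $e\in M^*$ and $b_e[0]>b_e[1]$, or $e\notin M^*$ and $b_e[1]>b_e[0]$. Max-product converges if there is a $k$ such that, for every (synchronous or asynchronous) schedule of updates, belief-maximizing assignments in $\{0,1\}$ to the edges remain constant once the associated computation trees are full up to depth $k$. It converges to $M^*$ if there is a $k$ such that, for every schedule, whenever $T_e$ is full up to depth $k$, one has $b_e[1]>b_e[0]$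 if and only if $e\in M^*$, and $b_e[1]<b_e[0]$ if and only if $e\notin M^*$. **Theorem.** If the LP relaxation is loose, then max-product does not converge to $M^*$: for every $k$ there are a $k_1\ge k$ and computation trees $T_e$, $e\in E$ (arising at one time of one run of max-product), each of them full up to depth $k_1$, such that the beliefs on some of the edges are incorrect. Moreover, max-product does not converge at all. -/

import Mathlib

namespace MaxProductMatching

/-! ### Weighted matchings and the linear programming relaxation -/

section Matching

variable {V : Type*} (G : SimpleGraph V)

/-- A matching of `G`: a set of edges of `G`, no two of which share a node. -/
def IsMatching (M : Finset (Sym2 V)) : Prop :=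
  (∀ e ∈ M, e ∈ G.edgeSet) ∧
    ∀ e ∈ M, ∀ f ∈ M, ∀ v : V, v ∈ e → v ∈ f → e = f

/-- The total weight of a set of edges. -/
def weight (w : Sym2 V → ℝ) (M : Finset (Sym2 V)) : ℝ := ∑ e ∈ M, w e

/-- `M` is the unique matching of `G` of largest weight. -/
def IsUniqueMaxWeightMatching (w : Sym2 V → ℝ) (M : Finset (Sym2 V)) : Prop :=
  IsMatching G M ∧ ∀ M' : Finset (Sym2 V), IsMatching G M' → M' ≠ M → weight w M' < weight w M

variable [Fintype V] [DecidableEq V] [DecidableRel G.Adj]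

/-- Feasible points of the LP relaxation: nonnegative edge variables whose sum over the edges
incident to any given node is at most one. -/
def LPFeasible (x : G.edgeSet → ℝ) : Prop :=
  (∀ e, 0 ≤ x e) ∧ ∀ i : V, ∑ e : G.edgeSet, (if i ∈ (e : Sym2 V) then x e else 0) ≤ 1

/-- The objective function of the LP relaxation. -/
def lpValue (w : Sym2 V → ℝ) (x : G.edgeSet → ℝ) : ℝ := ∑ e : G.edgeSet, w e * x e

/-- Optimal solutions of the LP relaxation. -/
def LPOptimal (w : Sym2 V → ℝ) (x : G.edgeSet → ℝ) : Prop :=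
  LPFeasible G x ∧ ∀ y, LPFeasible G y → lpValue G w y ≤ lpValue G w x

/-- The LP relaxation is tight: it has a unique optimal solution, and all the values of this
solution are `0` or `1`. -/
def LPTight (w : Sym2 V → ℝ) : Prop :=
  ∃ x, LPOptimal G w x ∧ (∀ y, LPOptimal G w y → y = x) ∧ ∀ e, x e = 0 ∨ x e = 1

/-- The LP relaxation is loose: it is not tight. -/
def LPLoose (w : Sym2 V → ℝ) : Prop := ¬ LPTight G w

end Matching

/-! ### The max-product algorithm -/

/-- The names of the messages. They are used for adjacent nodes `i`, `j` only. -/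
inductive Message (V : Type*) where
  /-- the message from the factor (node) `i` to the variable (edge) `(i, j)` -/
  | nodeToEdge (i j : V) : Message V
  /-- the message from the variable (edge) `(i, j)` to the factor (node) `i` -/
  | edgeToNode (i j : V) : Message V

/-- A (possibly asynchronous) schedule: the set of messages that are updated in each time slot.
The full synchronous algorithm is the schedule that is constantly `Set.univ`. -/
abbrev Schedule (V : Type*) := ℕ → Set (Message V)

section Algorithm

variable {V : Type*} [Fintype V] [DecidableEq V] (G : SimpleGraph V) [DecidableRel G.Adj]
  (w : Sym2 V → ℝ)

/-- The max-product update rule for the distribution on `{0, 1}`-valued edge variables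
`p(x) ∝ ∏ i, 𝟙[∑ j ∈ N(i), x (i, j) ≤ 1] * ∏ e, exp (w e * x e)`: the new value of each message,
a vector indexed by `0` and `1`, in terms of the current values `m` of all messages. -/
noncomputable def updateRule (m : Message V → Fin 2 → ℝ) : Message V → Fin 2 → ℝ
  | .edgeToNode i j, 1 => Real.exp (w s(i, j)) * m (.nodeToEdge j i) 1
  | .edgeToNode i j, 0 => m (.nodeToEdge j i) 0
  | .nodeToEdge i j, 1 => ∏ k ∈ (G.neighborFinset i).erase j, m (.edgeToNode i k) 0
  | .nodeToEdge i j, 0 =>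
      -- the maximum of the product and of all the terms given by `k`
      ((G.neighborFinset i).erase j).fold max
        (∏ k ∈ (G.neighborFinset i).erase j, m (.edgeToNode i k) 0)
        (fun k => m (.edgeToNode i k) 1 *
          ∏ l ∈ ((G.neighborFinset i).erase j).erase k, m (.edgeToNode i l) 0)

open Classical in
/-- The messages at time `t`: all of them are `(1, 1)` at time `0`, and in time slot `t` exactly
the messages in `S t` are updated. -/
noncomputable def messages (S : Schedule V) : ℕ → Message V → Fin 2 → ℝ
  | 0 => fun _ _ => 1
  | t + 1 => fun a => if a ∈ S t then updateRule G w (messages S t) a else messages S t a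

/-- The belief vector of the edge `(i, j)` at time `t`. -/
noncomputable def belief (S : Schedule V) (t : ℕ) (i j : V) : Fin 2 → ℝ
  | 0 => messages G w S t (.nodeToEdge i j) 0 * messages G w S t (.nodeToEdge j i) 0
  | 1 => Real.exp (w s(i, j)) * messages G w S t (.nodeToEdge i j) 1 *
      messages G w S t (.nodeToEdge j i) 1

/-- The belief of the edge `(i, j)` at time `t` is incorrect with respect to `M`. -/
def IncorrectBelief (M : Finset (Sym2 V)) (S : Schedule V) (t : ℕ) (i j : V) : Prop :=
  (s(i, j) ∈ M ∧ belief G w S t i j 1 < belief G w S t i j 0) ∨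
    (s(i, j) ∉ M ∧ belief G w S t i j 0 < belief G w S t i j 1)

end Algorithm

/-! ### Computation trees

A node of a computation tree is identified with the walk in `G`, starting along the root edge, that
leads to it: the list `[j, i, k₁, …, kₙ]` is a copy of `kₙ`, whose parent is `[j, i, k₁, …, kₙ₋₁]`.
The two endpoints of the root `(i, j)` are `[j, i]` (a copy of `i`) and `[i, j]` (a copy of `j`).
The branch of the tree at `[j, i]` is the set of lists `l` such that `[j, i] ++ l` is a node. -/

section Trees

variable {V : Type*} (G : SimpleGraph V)

/-- The tree rooted at the edge `(i, j)` with branches `B i j` (at the endpoint `i`) and `B j i`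
(at the endpoint `j`). -/
def rootedTree (B : V → V → Set (List V)) (i j : V) : Set (List V) :=
  {p | (∃ l ∈ B i j, p = j :: i :: l) ∨ (∃ l ∈ B j i, p = i :: j :: l)}

/-- The branch at `i` of the full computation tree of depth `d` whose root is `(i, j)`. Every node
has as children copies of all its neighbours in `G`, except for the one of its parent. -/
def fullBranch : ℕ → V → V → Set (List V)
  | 0 => fun _ _ => ∅
  | d + 1 => fun i j =>
      {p | p = [] ∨ ∃ k l, G.Adj i k ∧ k ≠ j ∧ l ∈ fullBranch d k i ∧ p = k :: l}

/-- The full computation tree of depth `d` rooted at the edge `(i, j)`; for `d = 1` it is just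
the edge, and for `d = 0` it is empty. -/
def fullTree (d : ℕ) (i j : V) : Set (List V) := rootedTree (fullBranch G d) i j

/-- How the computation tree behind a message is obtained from the trees behind the messages that
enter its update. -/
def branchUpdate (B : Message V → Set (List V)) : Message V → Set (List V)
  | .edgeToNode i j => B (.nodeToEdge j i)
  | .nodeToEdge i j =>
      {p | p = [] ∨ ∃ k l, G.Adj i k ∧ k ≠ j ∧ l ∈ B (.edgeToNode i k) ∧ p = k :: l}

open Classical in
/-- The computation tree behind each message at time `t`. At time `0`, a message from a node has
the bare node behind it, and a message from an edge has nothing behind it. -/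
noncomputable def messageBranch (S : Schedule V) : ℕ → Message V → Set (List V)
  | 0 => fun a => match a with
      | .nodeToEdge _ _ => {[]}
      | .edgeToNode _ _ => ∅
  | t + 1 => fun a => if a ∈ S t then branchUpdate G (messageBranch S t) a
      else messageBranch S t a

/-- The computation tree of the edge `(i, j)` at time `t`. -/
def computationTree (S : Schedule V) (t : ℕ) (i j : V) : Set (List V) :=
  rootedTree (fun a b => messageBranch G S t (.nodeToEdge a b)) i j

/-- The computation tree of `(i, j)` at time `t` is full up to depth `k`. -/
def FullUpTo (k : ℕ) (S : Schedule V) (t : ℕ) (i j : V) : Prop :=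
  fullTree G k i j ⊆ computationTree G S t i j

end Trees

/-! ### Convergence -/

section Convergence

variable {V : Type*} [Fintype V] [DecidableEq V] (G : SimpleGraph V) [DecidableRel G.Adj]
  (w : Sym2 V → ℝ)

/-- Max-product converges by step `k`: for all message schedules, belief-maximizing assignments of
the edge variables remain constant once the associated computation tree is full up to depth `k`. -/
def ConvergesByStep (k : ℕ) : Prop :=
  ∀ S : Schedule V, ∃ a : Sym2 V → Fin 2, ∀ (t : ℕ) (i j : V), G.Adj i j → FullUpTo G k S t i j →
    ∀ b : Fin 2, belief G w S t i j b ≤ belief G w S t i j (a s(i, j))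

/-- Max-product converges. -/
def Converges : Prop := ∃ k, ConvergesByStep G w k

/-- Max-product converges to `M`: from some depth of the computation trees on, the beliefs are
strictly in favour of `1` exactly on `M` and strictly in favour of `0` exactly off `M`. -/
def ConvergesTo (M : Finset (Sym2 V)) : Prop :=
  ∃ k, ∀ (S : Schedule V) (t : ℕ) (i j : V), G.Adj i j → FullUpTo G k S t i j →
    (belief G w S t i j 0 < belief G w S t i j 1 ↔ s(i, j) ∈ M) ∧
      (belief G w S t i j 1 < belief G w S t i j 0 ↔ s(i, j) ∉ M)

end Convergence

end MaxProductMatching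

namespace MaxProductMatching

/-! ### Strictly positive linear combinations -/

/-! For the ratio `r (i, j)` of the entries `0` and `1` of the message from node `i` to edge `(i,
j)`, two synchronous time slots amount to `r (i, j) ← max 1 (max over k ≠ j of exp (w (i, k)) / r
(k, i))`. This map is order-reversing, and the proof compares `r (i, j)` with `exp (y i)` for a dual
optimum `y`. Uniqueness of the primal optimum `x` supplies a `y` with strict complementary slackness
(`exists_strict_dual`) and saturates every node on the support of `x` (`load_eq_one_of_pos`), so
that `y` is positive there. Initially all ratios are `1`, hence below `exp (y i)` on the support. If
they are below on the support, two slots later they are above on edges with `x < 1`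
(`IsStrictDual.messagesAbove_add_two`); after two more they are again below on the support
(`IsStrictDual.messagesBelow_add_two`). Looseness gives an edge with `0 < x < 1`, subject to both
bounds. Its weight is `y i + y j`, so its belief flips every two slots forever, while the
computation trees become arbitrarily deep. -/

/-- A version of Stiemke's lemma: `w` is a combination of the vectors `v s` with strictly positive
coefficients, unless there is a nonzero functional that is nonpositive on all `v s` and nonnegative
on `w`. -/
lemma exists_pos_combination {ι E : Type*} [Fintype ι] [NormedAddCommGroup E] [NormedSpace ℝ E]
    [FiniteDimensional ℝ E] (v : ι → E) (w : E)
    (h : ∀ f : E →ₗ[ℝ] ℝ, (∀ s, f (v s) ≤ 0) → 0 ≤ f w → f = 0) :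
    ∃ p : ι → ℝ, (∀ s, 0 < p s) ∧ ∑ s, p s • v s = w := by
  classical
  set A : (ι → ℝ) →ₗ[ℝ] E := Fintype.linearCombination ℝ v with hA
  have hAapp : ∀ p, A p = ∑ s, p s • v s := fun p => Fintype.linearCombination_apply ℝ v p
  have hAv : ∀ s, A (Pi.single s 1) = v s := by
    intro s
    simp [hA, Fintype.linearCombination_apply_single]
  -- A functional vanishing on every `v s` satisfies the hypothesis up to sign, so it is zero and
  -- the `v s` span. Hence the image of the open orthant is open and can be strictly separated from
  -- `w`.
  have hsurj : Function.Surjective A := by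
    rw [← LinearMap.range_eq_top]
    by_contra hne
    obtain ⟨f, hf0, hf⟩ := Submodule.exists_le_ker_of_lt_top _ (lt_top_iff_ne_top.2 hne)
    have hfv : ∀ s, f (v s) = 0 := fun s => by
      have := hf (LinearMap.mem_range.2 ⟨_, hAv s⟩)
      simpa using this
    rcases le_total 0 (f w) with h0 | h0
    · exact hf0 (h f (fun s => (hfv s).le) h0)
    · have := h (-f) (fun s => by simp [hfv]) (by simpa using h0)
      exact hf0 (neg_eq_zero.1 this)
  have hopenMap : IsOpenMap A := LinearMap.isOpenMap_of_finiteDimensional A hsurj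
  set Q : Set (ι → ℝ) := {p | ∀ s, 0 < p s} with hQ
  have hQo : IsOpen Q := by
    have : Q = ⋂ s, {p : ι → ℝ | 0 < p s} := by ext; simp [hQ]
    rw [this]
    exact isOpen_iInter_of_finite fun s => isOpen_lt continuous_const (continuous_apply s)
  have hQc : Convex ℝ Q := by
    intro p hp q hq a b ha hb hab s
    have h1 := hp s
    have h2 := hq s
    simp only [Pi.add_apply, Pi.smul_apply, smul_eq_mul]
    rcases ha.eq_or_lt with rfl | ha'
    · have : b = 1 := by linarith
      subst this; simpa using h2
    · have := mul_pos ha' h1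
      have := mul_nonneg hb h2.le
      linarith
  by_contra hcon
  have hw : w ∉ A '' Q := by
    rintro ⟨p, hp, hpw⟩
    exact hcon ⟨p, hp, by rw [← hAapp]; exact hpw⟩
  obtain ⟨f, hf⟩ := geometric_hahn_banach_open_point (hQc.linear_image A) (hopenMap _ hQo) hw
  have hfQ : ∀ p ∈ Q, f (A p) < f w := fun p hp => hf _ ⟨p, hp, rfl⟩
  -- The orthant is a cone, so a bound by `f w` at all scales forces `0 ≤ f w` and `f ≤ 0` on its
  -- image.
  have hscale : ∀ p ∈ Q, ∀ t : ℝ, 0 < t → t * f (A p) < f w := by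
    intro p hp t ht
    have := hfQ (t • p) (fun s => by simpa using mul_pos ht (hp s))
    simpa using this
  have hfw : 0 ≤ f w := by
    by_contra hneg
    push Not at hneg
    have h1 := hfQ 1 (fun s => by simp)
    have h1' : f (A 1) < 0 := h1.trans hneg
    have := hscale 1 (fun s => by simp) (f w / (2 * f (A 1)))
      (div_pos_of_neg_of_neg hneg (by linarith))
    have h2 : f w / (2 * f (A 1)) * f (A 1) = f w / 2 := by
      have hne := h1'.ne
      field_simp
    linarith
  have hfnonpos : ∀ p ∈ Q, f (A p) ≤ 0 := by
    intro p hp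
    by_contra hpos
    push Not at hpos
    have := hscale p hp ((f w + 1) / f (A p)) (by positivity)
    rw [div_mul_cancel₀ _ hpos.ne'] at this
    linarith
  have hfv : ∀ s, f (v s) ≤ 0 := by
    intro s
    by_contra hpos
    push Not at hpos
    -- The vector `v s` comes from a boundary point of the orthant. Adding `1` moves it inside, and
    -- a large `t` makes this shift negligible.
    have hkey : ∀ t : ℝ, 0 < t → t * f (v s) + f (A 1) ≤ 0 := by
      intro t ht
      have := hfnonpos (t • Pi.single s 1 + 1) (fun r => by
        have : 0 ≤ (Pi.single s 1 : ι → ℝ) r := by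
          by_cases hr : r = s
          · subst hr; simp
          · simp [hr]
        simp only [Pi.add_apply, Pi.smul_apply, smul_eq_mul, Pi.one_apply]
        positivity)
      simpa [hAv] using this
    have := hkey ((|f (A 1)| + 1) / f (v s)) (by positivity)
    rw [div_mul_cancel₀ _ hpos.ne'] at this
    linarith [neg_abs_le (f (A 1))]
  have hzero := h f.toLinearMap (fun s => by simpa using hfv s) (by simpa using hfw)
  have hz : ∀ u, f u = 0 := fun u => by
    have := congrArg (fun g => g u) hzero
    simpa using this
  have := hfQ 1 (fun s => by simp)
  rw [hz, hz] at this
  exact lt_irrefl _ this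

/-! ### Uniqueness of the optimum of the linear program -/

section LP

variable {V : Type*} [Fintype V] [DecidableEq V] (G : SimpleGraph V) [DecidableRel G.Adj]

/-- The total value of the edges incident to a node. -/
def load (x : G.edgeSet → ℝ) (i : V) : ℝ := ∑ e : G.edgeSet, if i ∈ (e : Sym2 V) then x e else 0

variable {G} {w : Sym2 V → ℝ} {x : G.edgeSet → ℝ}

lemma load_add_smul (x d : G.edgeSet → ℝ) (t : ℝ) (i : V) :
    load G (x + t • d) i = load G x i + t * load G d i := by
  simp only [load, Finset.mul_sum, ← Finset.sum_add_distrib]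
  refine Finset.sum_congr rfl fun e _ => ?_
  split_ifs <;> simp

omit [DecidableEq V] in
lemma lpValue_add_smul (x d : G.edgeSet → ℝ) (t : ℝ) :
    lpValue G w (x + t • d) = lpValue G w x + t * lpValue G w d := by
  simp only [lpValue, Finset.mul_sum, ← Finset.sum_add_distrib]
  refine Finset.sum_congr rfl fun e _ => ?_
  simp only [Pi.add_apply, Pi.smul_apply, smul_eq_mul]
  ring

lemma LPFeasible.le_load (hx : LPFeasible G x) {i : V} {e : G.edgeSet} (hi : i ∈ (e : Sym2 V)) :
    x e ≤ load G x i := by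
  have := Finset.single_le_sum (s := Finset.univ)
    (f := fun e : G.edgeSet => if i ∈ (e : Sym2 V) then x e else 0)
    (fun e _ => by split_ifs; exacts [hx.1 e, le_rfl]) (Finset.mem_univ e)
  simpa [load, hi] using this

lemma LPFeasible.add_le_load (hx : LPFeasible G x) {i : V} {e f : G.edgeSet} (hef : e ≠ f)
    (he : i ∈ (e : Sym2 V)) (hf : i ∈ (f : Sym2 V)) : x e + x f ≤ load G x i := by
  have := Finset.sum_le_sum_of_subset_of_nonneg (Finset.subset_univ {e, f})
    (f := fun e : G.edgeSet => if i ∈ (e : Sym2 V) then x e else 0)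
    (fun e _ _ => by split_ifs; exacts [hx.1 e, le_rfl])
  rw [Finset.sum_pair hef] at this
  simpa [load, he, hf] using this

lemma LPFeasible.load_le_one (hx : LPFeasible G x) (i : V) : load G x i ≤ 1 := hx.2 i

lemma LPFeasible.le_one (hx : LPFeasible G x) (e : G.edgeSet) : x e ≤ 1 := by
  obtain ⟨e, he⟩ := e
  induction e using Sym2.ind with
  | _ i j => exact (hx.le_load (i := i) (by simp)).trans (hx.load_le_one i)

/-- No nonzero feasible direction at a unique optimum fails to decrease the objective. -/
lemma eq_zero_of_feasible_direction (hx : LPOptimal G w x) (hu : ∀ y, LPOptimal G w y → y = x)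
    (d : G.edgeSet → ℝ) (hd : ∀ e, x e = 0 → 0 ≤ d e)
    (hl : ∀ i, load G x i = 1 → load G d i ≤ 0) (hv : 0 ≤ lpValue G w d) : d = 0 := by
  -- For small `t > 0` the point `x + t • d` is feasible: tight constraints survive by the sign
  -- conditions on `d`, slack ones by continuity. It is then optimal, hence equal to `x`.
  have h1 : ∀ᶠ t : ℝ in nhdsWithin 0 (Set.Ioi 0), ∀ e, 0 ≤ x e + t * d e := by
    rw [Filter.eventually_all]
    intro e
    rcases (hx.1.1 e).eq_or_lt with h0 | h0
    · filter_upwards [self_mem_nhdsWithin] with t ht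
      rw [← h0, zero_add]
      exact mul_nonneg (le_of_lt ht) (hd e h0.symm)
    · have hc : Continuous fun t : ℝ => x e + t * d e := by fun_prop
      have := (hc.tendsto 0).eventually_const_lt (u := 0) (by simpa using h0)
      exact (this.filter_mono nhdsWithin_le_nhds).mono fun t ht => ht.le
  have h2 : ∀ᶠ t : ℝ in nhdsWithin 0 (Set.Ioi 0), ∀ i, load G x i + t * load G d i ≤ 1 := by
    rw [Filter.eventually_all]
    intro i
    rcases (hx.1.load_le_one i).eq_or_lt with h0 | h0
    · filter_upwards [self_mem_nhdsWithin] with t ht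
      have := mul_nonneg (le_of_lt (Set.mem_Ioi.1 ht)) (neg_nonneg.2 (hl i h0))
      linarith
    · have hc : Continuous fun t : ℝ => load G x i + t * load G d i := by fun_prop
      have := (hc.tendsto 0).eventually_lt_const (u := 1) (by simpa using h0)
      exact (this.filter_mono nhdsWithin_le_nhds).mono fun t ht => ht.le
  obtain ⟨t, ⟨ht1, ht2⟩, ht⟩ := ((h1.and h2).and self_mem_nhdsWithin).exists
  have ht : 0 < t := ht
  have hopt : LPOptimal G w (x + t • d) := by
    refine ⟨⟨fun e => by simpa using ht1 e, fun i => ?_⟩, fun y hy => ?_⟩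
    · have := ht2 i
      rwa [← load_add_smul] at this
    · rw [lpValue_add_smul]
      have := mul_nonneg ht.le hv
      linarith [hx.2 y hy]
  have := hu _ hopt
  ext e
  have he := congrFun this e
  simp only [Pi.add_apply, Pi.smul_apply, smul_eq_mul, add_eq_left, mul_eq_zero] at he
  exact he.resolve_left ht.ne'

omit [DecidableRel G.Adj] in
lemma sum_ite_mem_sym2 {R : Type*} [AddCommMonoid R] {i j : V} (hij : i ≠ j) (f : V → R) :
    (∑ a, if a ∈ s(i, j) then f a else 0) = f i + f j := by
  rw [← Finset.sum_filter, ← Finset.sum_pair hij]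
  refine Finset.sum_congr ?_ fun _ _ => rfl
  ext a
  simp

/-- Strict complementary slackness at a unique optimum. -/
lemma exists_strict_dual (hx : LPOptimal G w x) (hu : ∀ y, LPOptimal G w y → y = x) :
    ∃ y : V → ℝ, (∀ i, load G x i = 1 → 0 < y i) ∧ (∀ i, load G x i ≠ 1 → y i = 0) ∧
      ∀ (i j : V) (h : s(i, j) ∈ G.edgeSet), (x ⟨s(i, j), h⟩ = 0 → w s(i, j) < y i + y j) ∧
        (x ⟨s(i, j), h⟩ ≠ 0 → w s(i, j) = y i + y j) := by
  classical
  -- The normals of the constraints tight at `x`. A functional nonpositive on them is exactly a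
  -- feasible direction at `x`, which is what turns uniqueness into the hypothesis of Stiemke's
  -- lemma. Slack constraints contribute the zero vector.
  set a : V → G.edgeSet → ℝ := fun i =>
    if load G x i = 1 then fun e => if i ∈ (e : Sym2 V) then 1 else 0 else 0 with ha
  set b : G.edgeSet → G.edgeSet → ℝ := fun f => if x f = 0 then -Pi.single f 1 else 0 with hb
  obtain ⟨p, hp, hpw⟩ := exists_pos_combination (Sum.elim a b) (fun e => w e) (by
    intro f hf hw
    have hrep : ∀ u : G.edgeSet → ℝ, f u = ∑ e, u e * f (Pi.single e 1) := fun u => by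
      conv_lhs => rw [← Finset.univ_sum_single u, map_sum]
      refine Finset.sum_congr rfl fun e _ => ?_
      rw [← smul_eq_mul, ← map_smul, ← Pi.single_smul, smul_eq_mul, mul_one]
    have hd := eq_zero_of_feasible_direction hx hu (fun e => f (Pi.single e 1))
      (fun e he => by
        have := hf (Sum.inr e)
        simpa [hb, he] using this)
      (fun i hi => by
        have := hf (Sum.inl i)
        have hai : a i = fun e : G.edgeSet => if i ∈ (e : Sym2 V) then (1 : ℝ) else 0 := by
          rw [ha]
          exact if_pos hi
        rw [Sum.elim_inl, hai, hrep] at this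
        simpa only [load, ite_mul, one_mul, zero_mul] using this)
      (by rw [hrep] at hw; exact hw)
    refine LinearMap.ext fun u => ?_
    rw [hrep]
    refine Finset.sum_eq_zero fun e _ => ?_
    have := congrFun hd e
    simp only [Pi.zero_apply] at this
    rw [this, mul_zero])
  refine ⟨fun i => if load G x i = 1 then p (Sum.inl i) else 0, fun i hi => ?_,
    fun i hi => by simp [hi], fun i j h => ?_⟩
  · simp only [hi, if_true]
    exact hp _
  set y : V → ℝ := fun i => if load G x i = 1 then p (Sum.inl i) else 0 with hy
  have hcoord := congrFun hpw ⟨s(i, j), h⟩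
  have hnode : ∑ c, p (Sum.inl c) * a c ⟨s(i, j), h⟩ = y i + y j := by
    rw [← sum_ite_mem_sym2 (G.ne_of_adj h) y]
    refine Finset.sum_congr rfl fun c _ => ?_
    by_cases hc : load G x c = 1 <;> simp [ha, hy, hc]
  have hedge : ∑ f, p (Sum.inr f) * b f ⟨s(i, j), h⟩ =
      if x ⟨s(i, j), h⟩ = 0 then -p (Sum.inr ⟨s(i, j), h⟩) else 0 := by
    rw [Finset.sum_eq_single ⟨s(i, j), h⟩]
    · by_cases hc : x ⟨s(i, j), h⟩ = 0 <;> simp [hb, hc]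
    · intro f _ hf
      by_cases hc : x f = 0 <;> simp [hb, hc, hf.symm]
    · simp
  simp only [Fintype.sum_sum_type, Sum.elim_inl, Sum.elim_inr, Finset.sum_apply,
    Pi.smul_apply, smul_eq_mul] at hcoord
  rw [hnode, hedge] at hcoord
  refine ⟨fun h0 => ?_, fun h0 => ?_⟩
  · rw [if_pos h0] at hcoord
    linarith [hp (Sum.inr ⟨s(i, j), h⟩)]
  · rw [if_neg h0] at hcoord
    linarith

/-- At a unique optimum, all nodes on the support are saturated. -/
lemma load_eq_one_of_pos (hx : LPOptimal G w x) (hu : ∀ y, LPOptimal G w y → y = x)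
    {e : G.edgeSet} (he : 0 < x e) {i : V} (hi : i ∈ (e : Sym2 V)) : load G x i = 1 := by
  classical
  rcases (hx.1.le_one e).eq_or_lt with h1 | h1
  · exact le_antisymm (hx.1.load_le_one i) (h1 ▸ hx.1.le_load hi)
  -- Double counting of the fractional edges `F` at nodes: each node of `N` meets at least two of
  -- them and `i`, outside `N`, at least one, so `2 * F.card ≥ 2 * N.card + 1`, against `F.card ≤
  -- N.card`.
  by_contra hunsat
  set F : Finset G.edgeSet := Finset.univ.filter fun e => 0 < x e ∧ x e < 1 with hF
  set N : Finset V := Finset.univ.filter fun v => load G x v = 1 ∧ ∃ e ∈ F, v ∈ (e : Sym2 V) with hN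
  have hmemF : ∀ f, f ∈ F ↔ 0 < x f ∧ x f < 1 := fun f => by simp [hF]
  -- the incidence map from fractional edges to saturated nodes is injective
  have hcard : F.card ≤ N.card := by
    let ext : (F → ℝ) → G.edgeSet → ℝ := fun d e => if h : e ∈ F then d ⟨e, h⟩ else 0
    have hext : ∀ d (v : V), load G (ext d) v = ∑ f : F, if v ∈ (f.1 : Sym2 V) then d f else 0 := by
      intro d v
      rw [load, ← Finset.sum_subset (Finset.subset_univ F), ← Finset.sum_coe_sort]
      · refine Finset.sum_congr rfl fun f _ => ?_
        simp [ext]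
      · intro f _ hf
        simp [ext, hf]
    let L : (F → ℝ) →ₗ[ℝ] (N → ℝ) :=
      { toFun := fun d v => ∑ f : F, if v.1 ∈ (f.1 : Sym2 V) then d f else 0
        map_add' := fun d d' => by
          funext v
          simp only [Pi.add_apply, ← Finset.sum_add_distrib]
          refine Finset.sum_congr rfl fun f _ => ?_
          split_ifs <;> simp
        map_smul' := fun c d => by
          funext v
          simp [Finset.mul_sum] }
    have hL : Function.Injective L := by
      rw [injective_iff_map_eq_zero]
      intro d hd
      have hload : ∀ v, load G x v = 1 → load G (ext d) v = 0 := by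
        intro v hv
        rw [hext]
        by_cases hvN : v ∈ N
        · exact congrFun hd ⟨v, hvN⟩
        · refine Finset.sum_eq_zero fun f _ => if_neg fun hvf => hvN ?_
          simp only [hN, Finset.mem_filter, Finset.mem_univ, true_and]
          exact ⟨hv, f.1, f.2, hvf⟩
      have hzero : ∀ f, x f = 0 → ext d f = 0 := fun f hf => by
        have : f ∉ F := by rw [hmemF]; intro h; linarith [h.1]
        simp [ext, this]
      have hneg : ∀ v, load G (-ext d) v = -load G (ext d) v := fun v => by
        rw [load, load, ← Finset.sum_neg_distrib]
        refine Finset.sum_congr rfl fun f _ => ?_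
        split_ifs <;> simp
      -- A kernel vector and its negative are both feasible directions, and one of them does not
      -- decrease the objective.
      have hext0 : ext d = 0 := by
        rcases le_total 0 (lpValue G w (ext d)) with h | h
        · exact eq_zero_of_feasible_direction hx hu _ (fun f hf => (hzero f hf).ge)
            (fun v hv => (hload v hv).le) h
        · refine neg_eq_zero.1 (eq_zero_of_feasible_direction hx hu (-ext d)
            (fun f hf => by simp [hzero f hf]) (fun v hv => by rw [hneg, hload v hv, neg_zero]) ?_)
          simpa [lpValue] using h
      ext f
      have := congrFun hext0 f.1
      simpa [ext] using this
    simpa using LinearMap.finrank_le_finrank_of_injective hL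
  have hdouble : ∑ v : V, (F.filter fun f : G.edgeSet => v ∈ f.1).card = 2 * F.card := by
    simp only [Finset.card_filter]
    rw [Finset.sum_comm, mul_comm, ← smul_eq_mul, ← Finset.sum_const]
    refine Finset.sum_congr rfl fun f _ => ?_
    obtain ⟨f, hf⟩ := f
    induction f using Sym2.ind with
    | _ a b => exact sum_ite_mem_sym2 (R := ℕ) (G.ne_of_adj hf) fun _ => 1
  have hdeg : ∀ v ∈ N, 2 ≤ (F.filter fun f : G.edgeSet => v ∈ f.1).card := by
    intro v hv
    simp only [hN, Finset.mem_filter, Finset.mem_univ, true_and] at hv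
    obtain ⟨hv, f, hf, hvf⟩ := hv
    have hf' := (hmemF f).1 hf
    -- A fractional value alone cannot saturate `v`.
    obtain ⟨g, hgf, hvg, hg⟩ : ∃ g, g ≠ f ∧ v ∈ (g : Sym2 V) ∧ 0 < x g := by
      by_contra hcon
      push Not at hcon
      have : load G x v = x f := by
        rw [load, Finset.sum_eq_single f]
        · simp [hvf]
        · intro g _ hg
          split_ifs with hvg
          · exact le_antisymm (hcon g hg hvg) (hx.1.1 g)
          · rfl
        · simp
      linarith
    have hgF : g ∈ F := by
      rw [hmemF]
      exact ⟨hg, by linarith [hx.1.add_le_load hgf hvg hvf]⟩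
    rw [← Finset.card_pair hgf]
    refine Finset.card_le_card fun c hc => ?_
    simp only [Finset.mem_insert, Finset.mem_singleton] at hc
    rcases hc with rfl | rfl
    · simp [hgF, hvg]
    · simp [hf, hvf]
  have hiN : i ∉ N := by simp [hN, hunsat]
  have hdegi : 1 ≤ (F.filter fun f : G.edgeSet => i ∈ f.1).card :=
    Finset.card_pos.2 ⟨e, by simp [hmemF, he, h1, hi]⟩
  have hsub := Finset.sum_le_sum_of_subset (f := fun v => (F.filter fun f : G.edgeSet => v ∈ f.1).card)
    (Finset.subset_univ (insert i N))
  rw [Finset.sum_insert hiN] at hsub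
  have hsum := Finset.card_nsmul_le_sum N _ 2 hdeg
  rw [smul_eq_mul] at hsum
  omega

end LP


/-! ### The synchronous algorithm -/

section Synchronous

variable {V : Type*} [Fintype V] [DecidableEq V] {G : SimpleGraph V} [DecidableRel G.Adj]
  {w : Sym2 V → ℝ}

lemma messages_univ_succ (t : ℕ) (a : Message V) :
    messages G w (fun _ => Set.univ) (t + 1) a =
      updateRule G w (messages G w (fun _ => Set.univ) t) a := by
  simp [messages]

lemma messages_pos (S : Schedule V) (t : ℕ) (a : Message V) (b : Fin 2) :
    0 < messages G w S t a b := by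
  induction t generalizing a b with
  | zero => simp [messages]
  | succ t ih =>
    simp only [messages]
    split_ifs
    · cases a with
      | edgeToNode i j =>
        fin_cases b
        · exact ih _ _
        · exact mul_pos (Real.exp_pos _) (ih _ _)
      | nodeToEdge i j =>
        fin_cases b
        · exact (Finset.lt_fold_max 0).2 (Or.inl (Finset.prod_pos fun k _ => ih _ _))
        · exact Finset.prod_pos fun k _ => ih _ _
    · exact ih _ _

/-- The message from node `i` to edge `(i, j)` favours `0` over `1` by a factor less than `c` iff
`c > 1` and every message that enters it favours `1` over `0` by a factor less than `c`. -/
lemma updateRule_nodeToEdge_lt_iff {m : Message V → Fin 2 → ℝ} (hm : ∀ a b, 0 < m a b) (c : ℝ)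
    (i j : V) :
    updateRule G w m (.nodeToEdge i j) 0 < c * updateRule G w m (.nodeToEdge i j) 1 ↔
      1 < c ∧ ∀ k, G.Adj i k → k ≠ j → m (.edgeToNode i k) 1 < c * m (.edgeToNode i k) 0 := by
  simp only [updateRule]
  rw [Finset.fold_max_lt]
  have hP : 0 < ∏ k ∈ (G.neighborFinset i).erase j, m (.edgeToNode i k) 0 :=
    Finset.prod_pos fun k _ => hm _ _
  refine and_congr ?_ ⟨fun h k hk hkj => ?_, fun h k hk => ?_⟩
  · constructor
    · intro h
      by_contra hc
      exact absurd h (not_lt.2 (mul_le_of_le_one_left hP.le (not_lt.1 hc)))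
    · exact fun h => lt_mul_of_one_lt_left hP h
  · have hmem : k ∈ (G.neighborFinset i).erase j := by simp [hk, hkj]
    have := h k hmem
    -- With the factor of `k` split off, the remaining product is common to both sides and cancels.
    rw [← Finset.mul_prod_erase _ _ hmem, ← mul_assoc] at this
    exact lt_of_mul_lt_mul_right this (Finset.prod_nonneg fun k _ => (hm _ _).le)
  · have hk' : G.Adj i k ∧ k ≠ j := by
      simpa [and_comm] using hk
    rw [← Finset.mul_prod_erase _ _ hk, ← mul_assoc]
    exact mul_lt_mul_of_pos_right (h k hk'.1 hk'.2) (Finset.prod_pos fun k _ => hm _ _)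

/-- The message from node `i` to edge `(i, j)` favours `0` over `1` by a factor more than `c` iff
`c < 1` or some message that enters it favours `1` over `0` by a factor more than `c`. -/
lemma lt_updateRule_nodeToEdge_iff {m : Message V → Fin 2 → ℝ} (hm : ∀ a b, 0 < m a b) (c : ℝ)
    (i j : V) :
    c * updateRule G w m (.nodeToEdge i j) 1 < updateRule G w m (.nodeToEdge i j) 0 ↔
      c < 1 ∨ ∃ k, G.Adj i k ∧ k ≠ j ∧ c * m (.edgeToNode i k) 0 < m (.edgeToNode i k) 1 := by
  simp only [updateRule]
  rw [Finset.lt_fold_max]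
  have hP : 0 < ∏ k ∈ (G.neighborFinset i).erase j, m (.edgeToNode i k) 0 :=
    Finset.prod_pos fun k _ => hm _ _
  refine or_congr (mul_lt_iff_lt_one_left hP) (exists_congr fun k => ?_)
  have hmem : k ∈ (G.neighborFinset i).erase j ↔ G.Adj i k ∧ k ≠ j := by simp [and_comm]
  rw [← and_assoc, ← hmem]
  refine and_congr_right fun hk => ?_
  rw [← Finset.mul_prod_erase _ _ hk, ← mul_assoc]
  exact mul_lt_mul_iff_of_pos_right (Finset.prod_pos fun k _ => hm _ _)

/-- Two steps of the synchronous algorithm. -/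
lemma messages_univ_add_two_lt_iff (t : ℕ) (c : ℝ) (i j : V) :
    messages G w (fun _ => Set.univ) (t + 2) (.nodeToEdge i j) 0 <
        c * messages G w (fun _ => Set.univ) (t + 2) (.nodeToEdge i j) 1 ↔
      1 < c ∧ ∀ k, G.Adj i k → k ≠ j →
        Real.exp (w s(i, k)) * messages G w (fun _ => Set.univ) t (.nodeToEdge k i) 1 <
          c * messages G w (fun _ => Set.univ) t (.nodeToEdge k i) 0 := by
  rw [messages_univ_succ,
    updateRule_nodeToEdge_lt_iff fun a b => messages_pos _ _ a b]
  simp only [messages_univ_succ, updateRule]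

lemma lt_messages_univ_add_two_iff (t : ℕ) (c : ℝ) (i j : V) :
    c * messages G w (fun _ => Set.univ) (t + 2) (.nodeToEdge i j) 1 <
        messages G w (fun _ => Set.univ) (t + 2) (.nodeToEdge i j) 0 ↔
      c < 1 ∨ ∃ k, G.Adj i k ∧ k ≠ j ∧
        c * messages G w (fun _ => Set.univ) t (.nodeToEdge k i) 0 <
          Real.exp (w s(i, k)) * messages G w (fun _ => Set.univ) t (.nodeToEdge k i) 1 := by
  rw [messages_univ_succ,
    lt_updateRule_nodeToEdge_iff fun a b => messages_pos _ _ a b]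
  simp only [messages_univ_succ, updateRule]

/-! ### Depth of the synchronous computation trees -/

omit [Fintype V] [DecidableEq V] [DecidableRel G.Adj] in
lemma fullBranch_subset_messageBranch (r : ℕ) (i j : V) :
    fullBranch G (r + 1) i j ⊆ messageBranch G (fun _ => Set.univ) (2 * r) (.nodeToEdge i j) := by
  induction r generalizing i j with
  | zero =>
    rintro p (rfl | ⟨k, l, -, -, hl, -⟩)
    · simp [messageBranch]
    · exact hl.elim
  | succ r ih =>
    -- Each further level costs two time slots, one for the edge messages and one for the node
    -- messages.
    rw [Nat.mul_succ]
    rintro p (rfl | ⟨k, l, hk, hkj, hl, rfl⟩)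
    · simp [messageBranch, branchUpdate]
    · have hl' := ih k i hl
      simpa [messageBranch, branchUpdate, hk, hkj] using hl'

omit [Fintype V] [DecidableEq V] [DecidableRel G.Adj] in
lemma fullUpTo_univ (r : ℕ) (i j : V) : FullUpTo G (r + 1) (fun _ => Set.univ) (2 * r) i j := by
  rintro p (⟨l, hl, rfl⟩ | ⟨l, hl, rfl⟩)
  · exact Or.inl ⟨l, fullBranch_subset_messageBranch r _ _ hl, rfl⟩
  · exact Or.inr ⟨l, fullBranch_subset_messageBranch r _ _ hl, rfl⟩

omit [Fintype V] [DecidableEq V] [DecidableRel G.Adj] in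
lemma fullBranch_mono_succ (d : ℕ) (i j : V) : fullBranch G d i j ⊆ fullBranch G (d + 1) i j := by
  induction d generalizing i j with
  | zero => exact Set.empty_subset _
  | succ d ih =>
    rintro p (rfl | ⟨k, l, hk, hkj, hl, rfl⟩)
    · exact Or.inl rfl
    · exact Or.inr ⟨k, l, hk, hkj, ih k i hl, rfl⟩

omit [Fintype V] [DecidableEq V] [DecidableRel G.Adj] in
lemma fullTree_mono (i j : V) : Monotone fun d => fullTree G d i j := by
  refine monotone_nat_of_le_succ fun d => ?_
  rintro p (⟨l, hl, rfl⟩ | ⟨l, hl, rfl⟩)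
  · exact Or.inl ⟨l, fullBranch_mono_succ d _ _ hl, rfl⟩
  · exact Or.inr ⟨l, fullBranch_mono_succ d _ _ hl, rfl⟩

/-! ### Oscillation of the messages around the dual solution -/

variable {x : G.edgeSet → ℝ}

/-- Dual variables satisfying strict complementary slackness, with all nodes on the support of the
primal solution saturated. -/
structure IsStrictDual (G : SimpleGraph V) [DecidableRel G.Adj] (w : Sym2 V → ℝ)
    (x : G.edgeSet → ℝ) (y : V → ℝ) : Prop where
  pos_of_mem : ∀ e, 0 < x e → ∀ i ∈ (e : Sym2 V), 0 < y i
  eq_zero_of_load_ne : ∀ i, load G x i ≠ 1 → y i = 0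
  lt_of_eq_zero : ∀ (i j : V) (h : s(i, j) ∈ G.edgeSet), x ⟨s(i, j), h⟩ = 0 →
    w s(i, j) < y i + y j
  eq_of_pos : ∀ (i j : V) (h : s(i, j) ∈ G.edgeSet), 0 < x ⟨s(i, j), h⟩ → w s(i, j) = y i + y j

/-- The messages from nodes lie strictly below the dual solution along the support. -/
def MessagesBelow (x : G.edgeSet → ℝ) (y : V → ℝ) (m : Message V → Fin 2 → ℝ) : Prop :=
  ∀ (i j : V) (h : s(i, j) ∈ G.edgeSet), 0 < x ⟨s(i, j), h⟩ →
    m (.nodeToEdge i j) 0 < Real.exp (y i) * m (.nodeToEdge i j) 1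

/-- The messages from nodes lie above the dual solution, strictly so where it is positive, along
edges carrying a value other than one. -/
def MessagesAbove (x : G.edgeSet → ℝ) (y : V → ℝ) (m : Message V → Fin 2 → ℝ) : Prop :=
  ∀ (i j : V) (h : s(i, j) ∈ G.edgeSet), x ⟨s(i, j), h⟩ < 1 →
    Real.exp (y i) * m (.nodeToEdge i j) 1 ≤ m (.nodeToEdge i j) 0 ∧
      (0 < y i → Real.exp (y i) * m (.nodeToEdge i j) 1 < m (.nodeToEdge i j) 0)

omit [Fintype V] [DecidableEq V] [DecidableRel G.Adj] in
lemma apply_edge_comm (x : G.edgeSet → ℝ) {i j : V} (h : s(i, j) ∈ G.edgeSet)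
    (h' : s(j, i) ∈ G.edgeSet) : x ⟨s(j, i), h'⟩ = x ⟨s(i, j), h⟩ :=
  congrArg x (Subtype.ext Sym2.eq_swap)

/-- If `y i > 0`, then `i` is saturated, so an edge of value below one at `i` leaves room for
another support edge `(i, k)`. Its weight is `y i + y k` and the ratio from `k` is below `exp (y
k)`, which pushes the new ratio above `exp (y i)`. Otherwise the term `1` of the maximum suffices.
-/
lemma IsStrictDual.messagesAbove_add_two {y : V → ℝ} (hy : IsStrictDual G w x y)
    (hx : LPFeasible G x) {t : ℕ}
    (h : MessagesBelow x y (messages G w (fun _ => Set.univ) t)) :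
    MessagesAbove x y (messages G w (fun _ => Set.univ) (t + 2)) := by
  intro i j hij hlt
  have hstrict : 0 < y i → Real.exp (y i) * messages G w (fun _ => Set.univ) (t + 2)
      (.nodeToEdge i j) 1 < messages G w (fun _ => Set.univ) (t + 2) (.nodeToEdge i j) 0 := by
    intro hyi
    have hload : load G x i = 1 := by
      by_contra hne
      exact hyi.ne' (hy.eq_zero_of_load_ne i hne)
    obtain ⟨e, hne, hie, he⟩ : ∃ e : G.edgeSet, e ≠ ⟨s(i, j), hij⟩ ∧ i ∈ (e : Sym2 V) ∧ 0 < x e := by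
      by_contra hcon
      push Not at hcon
      have : load G x i = x ⟨s(i, j), hij⟩ := by
        rw [load, Finset.sum_eq_single ⟨s(i, j), hij⟩]
        · simp
        · intro e _ he
          split_ifs with hie
          · exact le_antisymm (hcon e he hie) (hx.1 e)
          · rfl
        · simp
      linarith
    obtain ⟨e, hemem⟩ := e
    obtain ⟨k, rfl⟩ := Sym2.mem_iff_exists.1 hie
    have hkj : k ≠ j := fun hkj => hne (by subst hkj; rfl)
    rw [lt_messages_univ_add_two_iff]
    refine Or.inr ⟨k, hemem, hkj, ?_⟩
    have hki : s(k, i) ∈ G.edgeSet := G.adj_symm hemem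
    have hbelow := h k i hki (by rwa [apply_edge_comm x hemem hki])
    rw [hy.eq_of_pos i k hemem he, Real.exp_add, mul_assoc]
    exact mul_lt_mul_of_pos_left hbelow (Real.exp_pos _)
  refine ⟨?_, hstrict⟩
  by_cases hyi : 0 < y i
  · exact (hstrict hyi).le
  · rw [← not_lt, messages_univ_add_two_lt_iff]
    rintro ⟨h1, -⟩
    exact hyi (Real.one_lt_exp_iff.1 h1)

/-- Every competing edge `(i, k)` has value below one, so the ratio from `k` is bounded below by
`exp (y k)`. Strictness comes from the slack in the dual constraint if the value is zero, and from
`y k > 0` if it is positive. -/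
lemma IsStrictDual.messagesBelow_add_two {y : V → ℝ} (hy : IsStrictDual G w x y)
    (hx : LPFeasible G x) {t : ℕ}
    (h : MessagesAbove x y (messages G w (fun _ => Set.univ) t)) :
    MessagesBelow x y (messages G w (fun _ => Set.univ) (t + 2)) := by
  intro i j hij hpos
  rw [messages_univ_add_two_lt_iff]
  refine ⟨Real.one_lt_exp_iff.2 (hy.pos_of_mem _ hpos i (by simp)), fun k hik hkj => ?_⟩
  have hik' : s(i, k) ∈ G.edgeSet := hik
  have hki : s(k, i) ∈ G.edgeSet := G.adj_symm hik
  have hne : (⟨s(i, k), hik'⟩ : G.edgeSet) ≠ ⟨s(i, j), hij⟩ := fun heq =>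
    hkj (Sym2.congr_right.1 (congrArg Subtype.val heq))
  have hlt : x ⟨s(i, k), hik'⟩ < 1 := by
    linarith [hx.add_le_load (i := i) hne (by simp) (by simp), hx.load_le_one i]
  obtain ⟨hle, hstrict⟩ := h k i hki (by rwa [apply_edge_comm x hik' hki])
  have hexp := Real.exp_pos (y i)
  have hm : 0 < messages G w (fun _ => Set.univ) t (.nodeToEdge k i) 1 := messages_pos _ _ _ _
  rcases (hx.1 ⟨s(i, k), hik'⟩).eq_or_lt with h0 | h0
  · have hw := hy.lt_of_eq_zero i k hik' h0.symm
    calc _ < Real.exp (y i + y k) * messages G w (fun _ => Set.univ) t (.nodeToEdge k i) 1 :=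
          mul_lt_mul_of_pos_right (Real.exp_lt_exp.2 hw) hm
      _ ≤ _ := by
          rw [Real.exp_add, mul_assoc]
          exact mul_le_mul_of_nonneg_left hle hexp.le
  · rw [hy.eq_of_pos i k hik' h0, Real.exp_add, mul_assoc]
    exact mul_lt_mul_of_pos_left (hstrict (hy.pos_of_mem _ h0 k (by simp))) hexp

lemma IsStrictDual.messagesBelow_univ {y : V → ℝ} (hy : IsStrictDual G w x y)
    (hx : LPFeasible G x) (r : ℕ) :
    MessagesBelow x y (messages G w (fun _ => Set.univ) (4 * r)) := by
  induction r with
  | zero =>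
    intro i j hij hpos
    -- The initial ratio is `1`, and `1 < exp (y i)` because `y i > 0` on the support.
    simpa [messages] using hy.pos_of_mem _ hpos i (by simp)
  | succ r ih => exact hy.messagesBelow_add_two hx (hy.messagesAbove_add_two hx ih)

/-- The belief of an edge of fractional value is in favour of `1` at times divisible by four. -/
lemma IsStrictDual.belief_lt {y : V → ℝ} (hy : IsStrictDual G w x y) (hx : LPFeasible G x)
    {i j : V} (h : s(i, j) ∈ G.edgeSet) (h0 : 0 < x ⟨s(i, j), h⟩) (r : ℕ) :
    belief G w (fun _ => Set.univ) (4 * r) i j 0 < belief G w (fun _ => Set.univ) (4 * r) i j 1 := by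
  have h' : s(j, i) ∈ G.edgeSet := G.adj_symm h
  have hij := hy.messagesBelow_univ hx r i j h h0
  have hji := hy.messagesBelow_univ hx r j i h' (by rwa [apply_edge_comm x h h'])
  -- The bounds at the two endpoints multiply to `exp (y i + y j)`, which is `exp` of the edge
  -- weight.
  have := mul_lt_mul'' hij hji (messages_pos _ _ _ _).le (messages_pos _ _ _ _).le
  simp only [belief]
  rw [hy.eq_of_pos i j h h0, Real.exp_add]
  linarith

/-- The belief of an edge of fractional value is in favour of `0` at times that are two modulo
four. -/
lemma IsStrictDual.lt_belief {y : V → ℝ} (hy : IsStrictDual G w x y) (hx : LPFeasible G x)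
    {i j : V} (h : s(i, j) ∈ G.edgeSet) (h0 : 0 < x ⟨s(i, j), h⟩) (h1 : x ⟨s(i, j), h⟩ < 1)
    (r : ℕ) :
    belief G w (fun _ => Set.univ) (4 * r + 2) i j 1 <
      belief G w (fun _ => Set.univ) (4 * r + 2) i j 0 := by
  have h' : s(j, i) ∈ G.edgeSet := G.adj_symm h
  have habove := hy.messagesAbove_add_two hx (hy.messagesBelow_univ hx r)
  have hij := (habove i j h h1).2 (hy.pos_of_mem _ h0 i (by simp))
  have hji := (habove j i h' (by rwa [apply_edge_comm x h h'])).2 (hy.pos_of_mem _ h0 j (by simp))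
  have := mul_lt_mul'' hij hji (mul_pos (Real.exp_pos _) (messages_pos _ _ _ _)).le
    (mul_pos (Real.exp_pos _) (messages_pos _ _ _ _)).le
  simp only [belief]
  rw [hy.eq_of_pos i j h h0, Real.exp_add]
  linarith

/-- If the LP relaxation has a unique optimum and is loose, then there is an edge whose beliefs in
the synchronous algorithm alternate forever. -/
lemma exists_edge_beliefs_alternate (hLP : ∃! x, LPOptimal G w x) (hloose : LPLoose G w) :
    ∃ i j : V, G.Adj i j ∧ ∀ r : ℕ,
      belief G w (fun _ => Set.univ) (4 * r) i j 0 < belief G w (fun _ => Set.univ) (4 * r) i j 1 ∧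
      belief G w (fun _ => Set.univ) (4 * r + 2) i j 1 <
        belief G w (fun _ => Set.univ) (4 * r + 2) i j 0 := by
  obtain ⟨x, hx, hu⟩ := hLP
  obtain ⟨e, he0, he1⟩ : ∃ e, x e ≠ 0 ∧ x e ≠ 1 := by
    by_contra hcon
    push Not at hcon
    exact hloose ⟨x, hx, hu, fun e => or_iff_not_imp_left.2 (hcon e)⟩
  obtain ⟨y, hsat, hunsat, hdual⟩ := exists_strict_dual hx hu
  have hy : IsStrictDual G w x y :=
    ⟨fun e he i hi => hsat i (load_eq_one_of_pos hx hu he hi), hunsat,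
      fun i j h => (hdual i j h).1, fun i j h h0 => (hdual i j h).2 h0.ne'⟩
  obtain ⟨e, he⟩ := e
  induction e using Sym2.ind with
  | _ i j =>
    have h0 := lt_of_le_of_ne (hx.1.1 _) he0.symm
    exact ⟨i, j, he, fun r => ⟨hy.belief_lt hx.1 he h0 r,
      hy.lt_belief hx.1 he h0 (lt_of_le_of_ne (hx.1.le_one _) he1) r⟩⟩

omit [Fintype V] [DecidableEq V] [DecidableRel G.Adj] in
lemma fullUpTo_univ_of_le {k r : ℕ} (h : k ≤ r + 1) (i j : V) :
    FullUpTo G k (fun _ => Set.univ) (2 * r) i j :=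
  (fullTree_mono i j h).trans (fullUpTo_univ r i j)

end Synchronous

end MaxProductMatching

/-! ### Failure of convergence -/

open MaxProductMatching in
theorem theorem2 {V : Type*} [Fintype V] [DecidableEq V] (G : SimpleGraph V) [DecidableRel G.Adj]
    (w : Sym2 V → ℝ) (hw : ∀ e ∈ G.edgeSet, 0 ≤ w e)
    (M : Finset (Sym2 V)) (hM : MaxProductMatching.IsUniqueMaxWeightMatching G w M)
    (hLP : ∃! x, MaxProductMatching.LPOptimal G w x)
    (hloose : MaxProductMatching.LPLoose G w) :
    (∀ k : ℕ, ∃ k₁ : ℕ, k ≤ k₁ ∧ ∃ (S : MaxProductMatching.Schedule V) (t : ℕ),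
      (∀ i j : V, G.Adj i j → MaxProductMatching.FullUpTo G k₁ S t i j) ∧
        ∃ i j : V, G.Adj i j ∧ MaxProductMatching.IncorrectBelief G w M S t i j) ∧
    ¬ MaxProductMatching.ConvergesTo G w M ∧
    ¬ MaxProductMatching.Converges G w := by
  obtain ⟨i, j, hij, hb⟩ := exists_edge_beliefs_alternate hLP hloose
  -- At time `4 * k` the trees are full up to depth `2 * k + 1`, so both phases of the oscillation
  -- occur beyond any depth `k`.
  have hfull : ∀ (k : ℕ) (i j : V), FullUpTo G k (fun _ => Set.univ) (4 * k) i j := fun k i j => by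
    have := fullUpTo_univ_of_le (G := G) (k := k) (r := 2 * k) (by omega) i j
    rwa [show 2 * (2 * k) = 4 * k by ring] at this
  have hfull' : ∀ (k : ℕ) (i j : V), FullUpTo G k (fun _ => Set.univ) (4 * k + 2) i j :=
    fun k i j => by
      have := fullUpTo_univ_of_le (G := G) (k := k) (r := 2 * k + 1) (by omega) i j
      rwa [show 2 * (2 * k + 1) = 4 * k + 2 by ring] at this
  refine ⟨fun k => ⟨k, le_rfl, fun _ => Set.univ, ?_⟩, ?_, ?_⟩
  -- The phase is chosen so that the belief contradicts the membership of the edge in `M`.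
  · by_cases hmem : s(i, j) ∈ M
    · exact ⟨4 * k + 2, fun a b _ => hfull' k a b, i, j, hij, Or.inl ⟨hmem, (hb k).2⟩⟩
    · exact ⟨4 * k, fun a b _ => hfull k a b, i, j, hij, Or.inr ⟨hmem, (hb k).1⟩⟩
  · rintro ⟨k, hk⟩
    have h1 := (hk _ _ i j hij (hfull k i j)).1.1 (hb k).1
    exact (hk _ _ i j hij (hfull' k i j)).2.1 (hb k).2 h1
  · rintro ⟨k, hk⟩
    obtain ⟨a, ha⟩ := hk fun _ => Set.univ
    have h1 := ha _ i j hij (hfull k i j) 1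
    have h0 := ha _ i j hij (hfull' k i j) 0
    generalize a s(i, j) = c at h0 h1
    fin_cases c
    · exact absurd h1 (not_le.2 (hb k).1)
    · exact absurd h0 (not_le.2 (hb k).2)
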